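/- Let $k\ge 1$ be a fixed integer, let $p(n)\in[0,1]$ for every $n$, and let $\varepsilon>0$. For each $n$ let $G(n,p(n))$ be the Erdős–Rényi random graph on $n$ nodes in which each of the $\binom n2$ possible links is present independently with probability $p(n)$. For a graph $g$ on a set $N$ of $n$ nodes we use the following terms. - A $k$-closed set is a nonempty set $S\subset N$ with at least $k$ and fewer than $n$ nodes such that every node outside $S$ has fewer than $k$ neighbors in $S$. - A $k$-core is a nonempty subgraph that is maximal among all subgraphs of $g$ in which every node has degree at least $k$ within the subgraph, and that has fewer than $n$ nodes. - A weak $k$-core is a nonempty subgraph with fewer than $n$ nodes, all of whose nodes have degree at least $k$ within the subgraph, such that every node outside it has fewer than $k$ neighbors in it. - A convention for the absolute threshold $t$ is a set $S\subset N$ such that every node in $S$ has at least $t$ neighbors in $S$ and every node outside $S$ has fewer than $t$ neighbors in $S$. It is proper if it is nonempty and has fewer than $n$ nodes, and it is tight if no nonempty strict subset of it is a convention for $t$. Then: 1. If $p(n)>(1+\varepsilon)\left(\frac{k\log n}{n}\right)^{1/k}$ for all sufficiently large $n$, then the probability that $G(n,p(n))$ has a $k$-closed set tends to $0$ as $n\to\infty$.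 So do the probabilities that it has a weak $k$-core, that it has a $k$-core, that it has a proper convention for the absolute threshold $t=k$, and that it has a proper tight convention for $t=k$. 2. If $p(n)<(1-\varepsilon)\left(\frac{k\log n}{n}\right)^{1/k}$ for all sufficiently large $n$, then the probability that $G(n,p(n))$ has a $k$-closed set tends to $1$ as $n\to\infty$; indeed the probability that it has a $k$-closed set with exactly $k$ nodes tends to $1$. Together, 1 and 2 say that $\left(\frac{k\log n}{n}\right)^{1/k}$ is a sharp threshold for the existence of a $k$-closed set. -/

import Mathlib

open Filter Topology

namespace NetworkCores

variable {n : ℕ}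

/-- The number of links in the network `G` from the node `v` to nodes of the group `S`. -/
noncomputable def linksTo (G : SimpleGraph (Fin n)) (v : Fin n) (S : Set (Fin n)) : ℕ :=
  {w | w ∈ S ∧ G.Adj v w}.ncard

/-- A `k`-closed set: a nonempty set of at least `k` and fewer than `n` nodes such that every node
outside of it has fewer than `k` links to it. -/
def IsKClosedSet (G : SimpleGraph (Fin n)) (k : ℕ) (S : Set (Fin n)) : Prop :=
  S.Nonempty ∧ k ≤ S.ncard ∧ S.ncard < n ∧ ∀ v, v ∉ S → linksTo G v S < k

/-- All nodes of the subgraph `H` have degree at least `k` within `H`. -/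
def HasMinDegree {G : SimpleGraph (Fin n)} (k : ℕ) (H : G.Subgraph) : Prop :=
  ∀ v, v ∈ H.verts → k ≤ (H.neighborSet v).ncard

/-- A (nonempty) `k`-core with fewer than `n` nodes: a nonempty subgraph that is maximal among all
the subgraphs of `G` in which every node has degree at least `k`, and that has fewer than `n`
nodes. -/
def IsKCore {G : SimpleGraph (Fin n)} (k : ℕ) (H : G.Subgraph) : Prop :=
  H.verts.Nonempty ∧ H.verts.ncard < n ∧ Maximal (fun H' : G.Subgraph => HasMinDegree k H') H

/-- A weak `k`-core: a nonempty subgraph with fewer than `n` nodes, in which all nodes have degree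
at least `k`, and such that no single further node would have degree at least `k` when added. -/
def IsWeakKCore {G : SimpleGraph (Fin n)} (k : ℕ) (H : G.Subgraph) : Prop :=
  H.verts.Nonempty ∧ H.verts.ncard < n ∧ HasMinDegree k H ∧
    ∀ v, v ∉ H.verts → linksTo G v H.verts < k

/-- A convention for the absolute threshold `t`: every member of `S` has at least `t` neighbors in
`S`, and every node outside `S` has fewer than `t` neighbors in `S`. -/
def IsConvention (G : SimpleGraph (Fin n)) (t : ℕ) (S : Set (Fin n)) : Prop :=
  (∀ v, v ∈ S → t ≤ linksTo G v S) ∧ ∀ v, v ∉ S → linksTo G v S < t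

/-- A proper convention: nonempty and involving less than all nodes. -/
def IsProperConvention (G : SimpleGraph (Fin n)) (t : ℕ) (S : Set (Fin n)) : Prop :=
  S.Nonempty ∧ S.ncard < n ∧ IsConvention G t S

/-- A proper tight convention: a proper convention none of whose nonempty strict subsets is a
convention. -/
def IsProperTightConvention (G : SimpleGraph (Fin n)) (t : ℕ) (S : Set (Fin n)) : Prop :=
  IsProperConvention G t S ∧ ∀ T, T ⊂ S → T.Nonempty → ¬ IsConvention G t T

/-- The probability, in the Erdős–Rényi model `G(n, q)` on `n` nodes with independent links of
probability `q`, of the graph property `P`. -/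
noncomputable def erProb (n : ℕ) (q : unitInterval) (P : SimpleGraph (Fin n) → Prop) : ℝ :=
  (SimpleGraph.binomialRandom (Fin n) q).real {G | P G}

/-- The threshold function `(k log n / n) ^ (1 / k)`. -/
noncomputable def coreThreshold (k n : ℕ) : ℝ :=
  ((k : ℝ) * Real.log n / n) ^ (1 / (k : ℝ))

end NetworkCores

/-! For a fixed set `S` of `m` nodes, the nodes outside `S` use disjoint sets of links to `S`, so
all of them have fewer than `k` links to `S` with probability `F ^ (n - m)`, where `F = P(Bin(m, p)
< k)`.

Above the threshold, a union bound gives the sum over `m` of `n.choose m * F ^ (n - m)`. Since `F`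
decreases in `p`, one may take `p` to be a constant multiple of the threshold, which tends to 0. For
`k ≥ 2` there are three ranges of `m`. If `m * p` is small, then `1 - F` is about `m.choose k * p ^
k`, and the term is at most `n ^ (-η * m)`. For larger `m` with `m * log n` at most a small multiple
of `n`, `F` is bounded away from 1 and `F ^ (n - m)` beats `n ^ m`. For the remaining `m`, a
Chernoff bound gives `n * F ≤ n ^ (-2)`. The case `k = 1` uses the symmetry between `m` and `n - m`
instead (`eventually_lowerTail_term_le`). Cores, weak cores and proper conventions all have
`k`-closed node sets, so they disappear too.

Below the threshold, the second moment method is applied to the number of `k`-closed sets of size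
`k`. Its mean is at least of order `n ^ (ε ^ 2 * k)`. Two distinct `k`-sets are nearly uncorrelated
because `p * p ^ k * n` tends to 0 (`erProb_forall_not_closedOutside_le`). -/

/-! ### The lower tail of the binomial distribution. -/

section LowerTail

/-- The probability that a binomial variable with `m` trials of success probability `p` is less
than `k`, as a function of `m` and `k`. -/
def lowerTail (p : ℝ) : ℕ → ℕ → ℝ
  | _, 0 => 0
  | 0, _ + 1 => 1
  | m + 1, k + 1 => p * lowerTail p m k + (1 - p) * lowerTail p m (k + 1)

variable {p : ℝ}

@[simp] lemma lowerTail_zero_right (p : ℝ) (m : ℕ) : lowerTail p m 0 = 0 := by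
  cases m <;> rfl

@[simp] lemma lowerTail_zero_succ (p : ℝ) (k : ℕ) : lowerTail p 0 (k + 1) = 1 := rfl

lemma lowerTail_succ_succ (p : ℝ) (m k : ℕ) : lowerTail p (m + 1) (k + 1) =
    p * lowerTail p m k + (1 - p) * lowerTail p m (k + 1) := rfl

lemma lowerTail_nonneg (h0 : 0 ≤ p) (h1 : p ≤ 1) (m k : ℕ) : 0 ≤ lowerTail p m k := by
  induction m generalizing k with
  | zero => cases k <;> simp
  | succ m ih =>
    cases k with
    | zero => simp
    | succ k =>
      rw [lowerTail_succ_succ]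
      have := mul_nonneg h0 (ih k)
      have := mul_nonneg (sub_nonneg.2 h1) (ih (k + 1))
      linarith

lemma lowerTail_le_succ_right (h0 : 0 ≤ p) (h1 : p ≤ 1) (m k : ℕ) :
    lowerTail p m k ≤ lowerTail p m (k + 1) := by
  induction m generalizing k with
  | zero => cases k <;> simp
  | succ m ih =>
    cases k with
    | zero => simpa using lowerTail_nonneg h0 h1 (m + 1) 1
    | succ k =>
      rw [lowerTail_succ_succ, lowerTail_succ_succ]
      have := mul_le_mul_of_nonneg_left (ih k) h0
      have := mul_le_mul_of_nonneg_left (ih (k + 1)) (sub_nonneg.2 h1)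
      linarith

/-- This allows `p` to be replaced by a fixed multiple of the threshold, which, unlike `p`, is known
to tend to 0. -/
lemma lowerTail_anti_prob {p' : ℝ} (h0 : 0 ≤ p) (h : p ≤ p') (h1 : p' ≤ 1) (m k : ℕ) :
    lowerTail p' m k ≤ lowerTail p m k := by
  induction m generalizing k with
  | zero => cases k <;> simp
  | succ m ih =>
    cases k with
    | zero => simp
    | succ k =>
      rw [lowerTail_succ_succ, lowerTail_succ_succ]
      have e1 := mul_le_mul_of_nonneg_left (ih k) (h0.trans h)
      have e2 := mul_le_mul_of_nonneg_left (ih (k + 1)) (sub_nonneg.2 h1)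
      have e3 := mul_le_mul_of_nonneg_left (lowerTail_le_succ_right h0 (h.trans h1) m k)
        (sub_nonneg.2 h)
      linarith

lemma lowerTail_succ_left_le (h0 : 0 ≤ p) (h1 : p ≤ 1) (m k : ℕ) :
    lowerTail p (m + 1) k ≤ lowerTail p m k := by
  cases k with
  | zero => simp
  | succ k =>
    rw [lowerTail_succ_succ]
    have := mul_le_mul_of_nonneg_left (lowerTail_le_succ_right h0 h1 m k) h0
    linarith

lemma lowerTail_anti_left (h0 : 0 ≤ p) (h1 : p ≤ 1) (k : ℕ) :
    Antitone fun m => lowerTail p m k :=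
  antitone_nat_of_succ_le fun m => lowerTail_succ_left_le h0 h1 m k

/-- Markov's inequality for `2 ^ (-X)` with `X` binomial, whose mean is `(1 - p / 2) ^ m`; the
induction follows the recursion. -/
lemma lowerTail_le_chernoff (h0 : 0 ≤ p) (h1 : p ≤ 1) (m k : ℕ) :
    lowerTail p m k ≤ 2 ^ k * (1 - p / 2) ^ m := by
  have hp : 0 ≤ 1 - p / 2 := by linarith
  induction m generalizing k with
  | zero =>
    cases k with
    | zero => simp
    | succ k => simpa using one_le_pow₀ (one_le_two (α := ℝ)) (n := k + 1)
  | succ m ih =>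
    cases k with
    | zero => simpa using pow_nonneg hp (m + 1)
    | succ k =>
      rw [lowerTail_succ_succ]
      have e1 := mul_le_mul_of_nonneg_left (ih k) h0
      have e2 := mul_le_mul_of_nonneg_left (ih (k + 1)) (sub_nonneg.2 h1)
      calc _ ≤ p * (2 ^ k * (1 - p / 2) ^ m) + (1 - p) * (2 ^ (k + 1) * (1 - p / 2) ^ m) :=
            add_le_add e1 e2
        _ = _ := by ring

lemma lowerTail_le_exp (h0 : 0 ≤ p) (h1 : p ≤ 1) (m k : ℕ) :
    lowerTail p m k ≤ 2 ^ k * Real.exp (-(m * p / 2)) := by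
  refine (lowerTail_le_chernoff h0 h1 m k).trans ?_
  gcongr
  calc (1 - p / 2) ^ m ≤ Real.exp (-(p / 2)) ^ m := by
        gcongr
        · linarith
        · linarith [Real.add_one_le_exp (-(p / 2))]
    _ = _ := by rw [← Real.exp_nat_mul]; ring_nf

/-- The complement contains the event of exactly `k` successes. The exponent `m` in place of `m - k`
only weakens the bound and lets Pascal's rule close the induction without truncated subtraction. -/
lemma lowerTail_le_one_sub (h0 : 0 ≤ p) (h1 : p ≤ 1) (m k : ℕ) :
    lowerTail p m k ≤ 1 - m.choose k * p ^ k * (1 - p) ^ m := by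
  have hq : 0 ≤ 1 - p := by linarith
  induction m generalizing k with
  | zero => cases k <;> simp
  | succ m ih =>
    cases k with
    | zero =>
      have : (1 - p) ^ (m + 1) ≤ 1 := pow_le_one₀ hq (by linarith)
      simp; linarith
    | succ k =>
      rw [lowerTail_succ_succ, Nat.choose_succ_succ]
      have e1 := mul_le_mul_of_nonneg_left (ih k) h0
      have e2 := mul_le_mul_of_nonneg_left (ih (k + 1)) hq
      have e3 : 0 ≤ p * (m.choose k * p ^ (k + 1) * (1 - p) ^ m) := by positivity
      push_cast
      calc _ ≤ _ := add_le_add e1 e2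
        _ = 1 - ((m.choose k : ℝ) + (m.choose (k + 1))) * p ^ (k + 1) * (1 - p) ^ (m + 1)
            - p * (m.choose k * p ^ (k + 1) * (1 - p) ^ m) := by ring
        _ ≤ _ := by linarith

lemma lowerTail_le_one_sub_linear (h0 : 0 ≤ p) (h1 : p ≤ 1) (m k : ℕ) :
    lowerTail p m k ≤ 1 - m.choose k * p ^ k * (1 - m * p) := by
  refine (lowerTail_le_one_sub h0 h1 m k).trans ?_
  have : 1 - m * p ≤ (1 - p) ^ m := by
    have := one_add_mul_le_pow (a := -p) (by linarith) m
    rw [← sub_eq_add_neg] at this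
    linarith
  gcongr

lemma lowerTail_one_right (p : ℝ) (m : ℕ) : lowerTail p m 1 = (1 - p) ^ m := by
  induction m with
  | zero => simp
  | succ m ih => rw [lowerTail_succ_succ, ih, lowerTail_zero_right]; ring

end LowerTail

namespace NetworkCores

open MeasureTheory ProbabilityTheory SimpleGraph

/-! ### Independence of the links of the random graph. -/

section Edges

variable {n : ℕ} {q : unitInterval}

instance : DiscreteMeasurableSpace (SimpleGraph (Fin n)) := by
  have : MeasurableSingletonClass (SimpleGraph (Fin n)) := ⟨fun G => by
    have h := measurable_edgeSet (MeasurableSet.singleton G.edgeSet)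
    have e : edgeSet ⁻¹' {G.edgeSet} = {G} := by
      ext H; simp
    rwa [e] at h⟩
  infer_instance

/-- The graph property `P` depends only on which links of `A` are present. -/
def DependsOnLinks (A : Finset (Sym2 (Fin n))) (P : SimpleGraph (Fin n) → Prop) : Prop :=
  ∀ G H : SimpleGraph (Fin n), (∀ e ∈ A, e ∈ G.edgeSet ↔ e ∈ H.edgeSet) → (P G ↔ P H)

lemma erProb_nonneg (P : SimpleGraph (Fin n) → Prop) : 0 ≤ erProb n q P := measureReal_nonneg

lemma erProb_le_one (P : SimpleGraph (Fin n) → Prop) : erProb n q P ≤ 1 := measureReal_le_one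

lemma erProb_mono {P Q : SimpleGraph (Fin n) → Prop} (h : ∀ G, P G → Q G) :
    erProb n q P ≤ erProb n q Q := measureReal_mono h

lemma erProb_not (P : SimpleGraph (Fin n) → Prop) :
    erProb n q (fun G => ¬ P G) = 1 - erProb n q P :=
  probReal_compl_eq_one_sub (μ := binomialRandom (Fin n) q) (s := {G | P G}) .of_discrete

lemma erProb_or_of_disjoint {P Q : SimpleGraph (Fin n) → Prop} (h : ∀ G, P G → ¬ Q G) :
    erProb n q (fun G => P G ∨ Q G) = erProb n q P + erProb n q Q :=
  measureReal_union (μ := binomialRandom (Fin n) q) (s₁ := {G | P G}) (s₂ := {G | Q G})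
    (Set.disjoint_left.2 h) .of_discrete

lemma map_links_binomialRandom :
    (binomialRandom (Fin n) q).map (fun G e => e ∈ G.edgeSet) =
      Measure.infinitePi fun e : Sym2 (Fin n) =>
        (unitInterval.toNNReal q • Measure.dirac (e ∈ Sym2.diagSetᶜ) +
          unitInterval.toNNReal (unitInterval.symm q) • Measure.dirac False : Measure Prop) := by
  have h1 : (binomialRandom (Fin n) q).map edgeSet = setBernoulli Sym2.diagSetᶜ q := by
    rw [binomialRandom, measurableEmbedding_edgeSet.map_comap]
    -- Mapping back a comap restricts to the range of `edgeSet`. Nothing is lost, since almost every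
    -- random set avoids the diagonal and is therefore an edge set.
    refine Measure.restrict_eq_self_of_ae_mem ?_
    filter_upwards [setBernoulli_ae_subset] with s hs
    refine ⟨fromEdgeSet s, ?_⟩
    rw [edgeSet_fromEdgeSet, sdiff_eq_left]
    exact Set.disjoint_left.2 fun e he => hs he
  have h2 : (fun (G : SimpleGraph (Fin n)) (e : Sym2 (Fin n)) => e ∈ G.edgeSet) =
      (fun (s : Set (Sym2 (Fin n))) e => e ∈ s) ∘ edgeSet := rfl
  rw [h2, ← Measure.map_map .of_discrete .of_discrete, h1, setBernoulli_eq_map,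
    Measure.map_map .of_discrete .of_discrete]
  exact Measure.map_id

lemma iIndepFun_links :
    iIndepFun (fun (e : Sym2 (Fin n)) (G : SimpleGraph (Fin n)) => e ∈ G.edgeSet)
      (binomialRandom (Fin n) q) := by
  rw [iIndepFun_iff_map_fun_eq_infinitePi_map fun _ => .of_discrete, map_links_binomialRandom]
  congr 1
  funext e
  have : (fun G : SimpleGraph (Fin n) => e ∈ G.edgeSet) =
      (fun f : Sym2 (Fin n) → Prop => f e) ∘ (fun G e => e ∈ G.edgeSet) := rfl
  rw [this, ← Measure.map_map (measurable_pi_apply e) .of_discrete, map_links_binomialRandom,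
    Measure.infinitePi_map_eval]

lemma erProb_link {e : Sym2 (Fin n)} (he : ¬ e.IsDiag) :
    erProb n q (fun G => e ∈ G.edgeSet) = q := by
  have h : (binomialRandom (Fin n) q).map (fun G : SimpleGraph (Fin n) => e ∈ G.edgeSet) =
      (unitInterval.toNNReal q • Measure.dirac (e ∈ Sym2.diagSetᶜ) +
          unitInterval.toNNReal (unitInterval.symm q) • Measure.dirac False : Measure Prop) := by
    have : (fun G : SimpleGraph (Fin n) => e ∈ G.edgeSet) =
      (fun f : Sym2 (Fin n) → Prop => f e) ∘ (fun G e => e ∈ G.edgeSet) := rfl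
    rw [this, ← Measure.map_map (measurable_pi_apply e) .of_discrete, map_links_binomialRandom,
      Measure.infinitePi_map_eval]
  have h2 := congrArg (fun μ : Measure Prop => μ.real {True}) h
  simp only [map_measureReal_apply (μ := binomialRandom (Fin n) q) .of_discrete
    (MeasurableSet.of_discrete (s := {True}))] at h2
  have h3 : (fun G : SimpleGraph (Fin n) => e ∈ G.edgeSet) ⁻¹' {True} =
      {G | e ∈ G.edgeSet} := by ext; simp
  rw [h3] at h2
  rw [erProb, h2]
  simp [Measure.real, he]

lemma DependsOnLinks.erProb_and {A B : Finset (Sym2 (Fin n))}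
    {P Q : SimpleGraph (Fin n) → Prop} (hP : DependsOnLinks A P) (hQ : DependsOnLinks B Q)
    (hAB : Disjoint A B) :
    erProb n q (fun G => P G ∧ Q G) = erProb n q P * erProb n q Q := by
  -- Such a property is an event in the indicators of the links of `A`, so independence of disjoint
  -- blocks of indicators applies.
  have key : ∀ (A : Finset (Sym2 (Fin n))) (P : SimpleGraph (Fin n) → Prop),
      DependsOnLinks A P → ∃ C : Set (A → Prop),
        {G | P G} = (fun (G : SimpleGraph (Fin n)) (e : A) => e.1 ∈ G.edgeSet) ⁻¹' C := by
    intro A P hP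
    refine ⟨(fun (G : SimpleGraph (Fin n)) (e : A) => e.1 ∈ G.edgeSet) '' {G | P G}, ?_⟩
    ext G
    refine ⟨fun h => ⟨G, h, rfl⟩, ?_⟩
    rintro ⟨H, hH, hHG⟩
    exact (hP H G fun e he => Iff.of_eq (congrFun hHG ⟨e, he⟩)).1 hH
  obtain ⟨C, hC⟩ := key A P hP
  obtain ⟨D, hD⟩ := key B Q hQ
  have h := (iIndepFun_links (q := q)).indepFun_finset A B hAB fun _ => .of_discrete
  have h' := h.measure_inter_preimage_eq_mul C D .of_discrete .of_discrete
  rw [← hC, ← hD] at h'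
  simp only [erProb, Measure.real, ← ENNReal.toReal_mul]
  rw [← h']; rfl

lemma DependsOnLinks.mono {A B : Finset (Sym2 (Fin n))} {P : SimpleGraph (Fin n) → Prop}
    (hP : DependsOnLinks A P) (h : A ⊆ B) : DependsOnLinks B P :=
  fun G H hGH => hP G H fun e he => hGH e (h he)

lemma DependsOnLinks.not {A : Finset (Sym2 (Fin n))} {P : SimpleGraph (Fin n) → Prop}
    (hP : DependsOnLinks A P) : DependsOnLinks A (fun G => ¬ P G) :=
  fun G H hGH => not_congr (hP G H hGH)

lemma DependsOnLinks.and {A : Finset (Sym2 (Fin n))} {P Q : SimpleGraph (Fin n) → Prop}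
    (hP : DependsOnLinks A P) (hQ : DependsOnLinks A Q) : DependsOnLinks A (fun G => P G ∧ Q G) :=
  fun G H hGH => and_congr (hP G H hGH) (hQ G H hGH)

lemma DependsOnLinks.forall_mem {ι : Type*} {A : Finset (Sym2 (Fin n))} {s : Finset ι}
    {P : ι → SimpleGraph (Fin n) → Prop} (hP : ∀ i ∈ s, DependsOnLinks A (P i)) :
    DependsOnLinks A (fun G => ∀ i ∈ s, P i G) :=
  fun G H hGH => forall₂_congr fun i hi => hP i hi G H hGH

/-- Properties that depend on pairwise disjoint sets of links are independent. -/
lemma erProb_forall_mem {ι : Type*} (s : Finset ι) (A : ι → Finset (Sym2 (Fin n)))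
    (P : ι → SimpleGraph (Fin n) → Prop) (hP : ∀ i ∈ s, DependsOnLinks (A i) (P i))
    (hA : (s : Set ι).PairwiseDisjoint A) :
    erProb n q (fun G => ∀ i ∈ s, P i G) = ∏ i ∈ s, erProb n q (P i) := by
  classical
  induction s using Finset.induction_on with
  | empty => simp [erProb]
  | insert a s ha ih =>
    rw [Finset.prod_insert ha, ← ih (fun i hi => hP i (by simp [hi]))
      (hA.subset (by simp)), ← DependsOnLinks.erProb_and (A := A a) (B := s.biUnion A)
      (hP a (by simp))]
    · simp only [Finset.forall_mem_insert]
    · exact DependsOnLinks.forall_mem fun i hi =>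
        (hP i (by simp [hi])).mono (Finset.subset_biUnion_of_mem A hi)
    · rw [Finset.disjoint_biUnion_right]
      intro i hi
      exact hA (by simp) (by simp [hi]) (by rintro rfl; exact ha hi)

lemma dependsOnLinks_link {A : Finset (Sym2 (Fin n))} {e : Sym2 (Fin n)} (he : e ∈ A) :
    DependsOnLinks A (fun G => e ∈ G.edgeSet) := fun _ _ h => h e he

end Edges

end NetworkCores

namespace NetworkCores

open MeasureTheory ProbabilityTheory SimpleGraph

/-! ### Probabilities of closedness; first and second moments. -/

section Events

variable {n : ℕ} {q : unitInterval}

lemma erProb_exists_mem_le {ι : Type*} (s : Finset ι) (P : ι → SimpleGraph (Fin n) → Prop) :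
    erProb n q (fun G => ∃ i ∈ s, P i G) ≤ ∑ i ∈ s, erProb n q (P i) := by
  refine le_trans (le_of_eq ?_) (measureReal_biUnion_finset_le s fun i => {G | P i G})
  unfold erProb
  congr 1
  ext G
  simp

open Classical in
lemma erProb_eq_sum (P : SimpleGraph (Fin n) → Prop) :
    erProb n q P = ∑ G, (binomialRandom (Fin n) q).real {G} * if P G then 1 else 0 := by
  simp only [mul_ite, mul_one, mul_zero, ← Finset.sum_filter]
  rw [sum_measureReal_singleton, erProb]
  simp

/-- The second moment method: a bound on the probability that none of the properties `P i`
holds. -/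
lemma erProb_forall_not_mul_sq_le {ι : Type*} (s : Finset ι)
    (P : ι → SimpleGraph (Fin n) → Prop) :
    erProb n q (fun G => ∀ i ∈ s, ¬ P i G) * (∑ i ∈ s, erProb n q (P i)) ^ 2 ≤
      (∑ i ∈ s, ∑ j ∈ s, erProb n q (fun G => P i G ∧ P j G)) -
        (∑ i ∈ s, erProb n q (P i)) ^ 2 := by
  classical
  set w : SimpleGraph (Fin n) → ℝ := fun G => (binomialRandom (Fin n) q).real {G} with hw
  have hw0 : ∀ G, 0 ≤ w G := fun G => measureReal_nonneg
  have hw1 : ∑ G, w G = 1 := by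
    rw [hw, sum_measureReal_singleton]; simp
  set X : SimpleGraph (Fin n) → ℝ := fun G => ∑ i ∈ s, if P i G then 1 else 0 with hX
  set E := ∑ i ∈ s, erProb n q (P i) with hE
  have hE' : E = ∑ G, w G * X G := by
    simp only [hE, hX, erProb_eq_sum, Finset.mul_sum]
    rw [Finset.sum_comm]
  have hE2 : (∑ i ∈ s, ∑ j ∈ s, erProb n q (fun G => P i G ∧ P j G)) = ∑ G, w G * X G ^ 2 := by
    simp only [erProb_eq_sum, hX, sq, Finset.sum_mul_sum]
    simp only [Finset.mul_sum]
    rw [Finset.sum_comm (s := Finset.univ)]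
    refine Finset.sum_congr rfl fun i _ => ?_
    rw [Finset.sum_comm]
    refine Finset.sum_congr rfl fun G _ => Finset.sum_congr rfl fun j _ => ?_
    by_cases h1 : P i G <;> by_cases h2 : P j G <;> simp [h1, h2, hw]
  have hvar : ∑ G, w G * (X G - E) ^ 2 = (∑ G, w G * X G ^ 2) - E ^ 2 := by
    have : ∀ G, w G * (X G - E) ^ 2 = w G * X G ^ 2 - 2 * E * (w G * X G) + E ^ 2 * w G := by
      intro G; ring
    simp only [this, Finset.sum_add_distrib, Finset.sum_sub_distrib, ← Finset.mul_sum, hw1, ← hE']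
    ring
  rw [hE2, ← hvar, erProb_eq_sum, Finset.sum_mul]
  refine Finset.sum_le_sum fun G _ => ?_
  rw [mul_assoc]
  refine mul_le_mul_of_nonneg_left ?_ (hw0 G)
  -- Chebyshev's argument: where the count `X` vanishes, `(X - E) ^ 2` equals `E ^ 2`.
  split_ifs with h
  · have : X G = 0 := Finset.sum_eq_zero fun i hi => by simp [h i hi]
    rw [this]; simp
  · rw [zero_mul]; positivity

lemma erProb_forall_link (A : Finset (Sym2 (Fin n))) (hA : ∀ e ∈ A, ¬ e.IsDiag) :
    erProb n q (fun G => ∀ e ∈ A, e ∈ G.edgeSet) = (q : ℝ) ^ A.card := by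
  rw [erProb_forall_mem A (fun e => {e}) (fun e G => e ∈ G.edgeSet)
    (fun e _ => dependsOnLinks_link (by simp)) (by simp [Set.PairwiseDisjoint, Set.Pairwise]),
    Finset.prod_congr rfl fun e he => erProb_link (hA e he)]
  simp

open Classical in
lemma dependsOnLinks_card (A : Finset (Sym2 (Fin n))) (k : ℕ) :
    DependsOnLinks A (fun G => {e ∈ A | e ∈ G.edgeSet}.card < k) := by
  intro G H h
  simp only [Finset.filter_congr h]

open Classical in
/-- The number of links present among those of `A` has a binomial distribution. -/
lemma erProb_card_links_lt (A : Finset (Sym2 (Fin n))) (hA : ∀ e ∈ A, ¬ e.IsDiag) (k : ℕ) :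
    erProb n q (fun G => {e ∈ A | e ∈ G.edgeSet}.card < k) = lowerTail q A.card k := by
  induction A using Finset.induction_on generalizing k with
  | empty => cases k <;> simp [erProb]
  | insert a s ha ih =>
    cases k with
    | zero => simp [erProb]
    | succ k =>
      have hs : ∀ e ∈ s, ¬ e.IsDiag := fun e he => hA e (by simp [he])
      have hdis : Disjoint {a} s := by simpa using ha
      have h1 : ∀ G : SimpleGraph (Fin n),
          ({e ∈ insert a s | e ∈ G.edgeSet}.card < k + 1) ↔
          ((a ∈ G.edgeSet ∧ {e ∈ s | e ∈ G.edgeSet}.card < k) ∨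
            (¬ a ∈ G.edgeSet ∧ {e ∈ s | e ∈ G.edgeSet}.card < k + 1)) := by
        intro G
        rw [Finset.filter_insert]
        by_cases h : a ∈ G.edgeSet
        · simp [h, ha]
        · simp [h]
      have hd : DependsOnLinks {a} (fun G : SimpleGraph (Fin n) => a ∈ G.edgeSet) :=
        dependsOnLinks_link (by simp)
      simp only [h1]
      rw [erProb_or_of_disjoint (by tauto), hd.erProb_and (dependsOnLinks_card s k) hdis,
        hd.not.erProb_and (dependsOnLinks_card s (k + 1)) hdis, erProb_not,
        erProb_link (hA a (by simp)), ih hs, ih hs, Finset.card_insert_of_notMem ha,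
        lowerTail_succ_succ]

/-- The possible links from `v` to the nodes of `S`. -/
def starLinks (v : Fin n) (S : Finset (Fin n)) : Finset (Sym2 (Fin n)) := S.image fun w => s(v, w)

lemma mem_starLinks {v : Fin n} {S : Finset (Fin n)} {e : Sym2 (Fin n)} :
    e ∈ starLinks v S ↔ ∃ w ∈ S, s(v, w) = e := by simp [starLinks]

lemma card_starLinks (v : Fin n) (S : Finset (Fin n)) : (starLinks v S).card = S.card :=
  Finset.card_image_of_injective _ fun a b h => by
    simp only [Sym2.eq_iff] at h
    grind

lemma not_isDiag_of_mem_starLinks {v : Fin n} {S : Finset (Fin n)} (hv : v ∉ S) :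
    ∀ e ∈ starLinks v S, ¬ e.IsDiag := by
  intro e he
  obtain ⟨w, hw, rfl⟩ := mem_starLinks.1 he
  rintro h
  have : v = w := by simpa using h
  exact hv (this ▸ hw)

/-- A link shared by two distinct centers would join them, putting one of the centers in `S`. -/
lemma pairwiseDisjoint_starLinks (S : Finset (Fin n)) :
    ((Sᶜ : Finset (Fin n)) : Set (Fin n)).PairwiseDisjoint fun v => starLinks v S := by
  intro v hv v' hv' hne
  refine Finset.disjoint_left.2 fun e he he' => ?_
  obtain ⟨w, hw, rfl⟩ := mem_starLinks.1 he
  obtain ⟨w', hw', h⟩ := mem_starLinks.1 he'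
  rw [Sym2.eq_iff] at h
  rcases h with ⟨h, -⟩ | ⟨h, -⟩
  · exact hne h.symm
  · rw [h] at hv'
    simp [hw] at hv'

open Classical in
lemma linksTo_eq_card (G : SimpleGraph (Fin n)) (v : Fin n) (S : Finset (Fin n)) :
    linksTo G v S = {e ∈ starLinks v S | e ∈ G.edgeSet}.card := by
  have h1 : {w | w ∈ (S : Set (Fin n)) ∧ G.Adj v w} = ({w ∈ S | G.Adj v w} : Finset (Fin n)) := by
    ext; simp
  have h2 : {e ∈ starLinks v S | e ∈ G.edgeSet} = starLinks v {w ∈ S | G.Adj v w} := by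
    rw [starLinks, starLinks, Finset.filter_image]
    simp only [mem_edgeSet]
  rw [h2, card_starLinks, linksTo, h1, Set.ncard_coe_finset]

/-- Every node outside of `S` has fewer than `k` links to `S`. -/
def ClosedOutside (k : ℕ) (S : Finset (Fin n)) (G : SimpleGraph (Fin n)) : Prop :=
  ∀ v ∈ Sᶜ, linksTo G v S < k

lemma dependsOnLinks_linksTo_lt (v : Fin n) (S : Finset (Fin n)) (k : ℕ) :
    DependsOnLinks (starLinks v S) (fun G => linksTo G v S < k) := by
  classical
  simp only [linksTo_eq_card]
  exact dependsOnLinks_card _ _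

lemma erProb_linksTo_lt {v : Fin n} {S : Finset (Fin n)} (hv : v ∉ S) (k : ℕ) :
    erProb n q (fun G => linksTo G v S < k) = lowerTail q S.card k := by
  classical
  simp only [linksTo_eq_card]
  rw [erProb_card_links_lt _ (not_isDiag_of_mem_starLinks hv), card_starLinks]

lemma erProb_closedOutside (k : ℕ) (S : Finset (Fin n)) :
    erProb n q (ClosedOutside k S) = lowerTail q S.card k ^ (n - S.card) := by
  unfold ClosedOutside
  rw [erProb_forall_mem Sᶜ (fun v => starLinks v S) (fun v G => linksTo G v S < k)
    (fun v _ => dependsOnLinks_linksTo_lt v S k) (pairwiseDisjoint_starLinks S),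
    Finset.prod_congr rfl fun v hv => erProb_linksTo_lt (Finset.mem_compl.1 hv) k]
  simp [Finset.card_compl]

lemma erProb_exists_isKClosedSet_le (k : ℕ) :
    erProb n q (fun G => ∃ S, IsKClosedSet G k S) ≤
      ∑ m ∈ Finset.Ico k n, (n.choose m : ℝ) * lowerTail q m k ^ (n - m) := by
  classical
  calc erProb n q (fun G => ∃ S, IsKClosedSet G k S)
      ≤ erProb n q (fun G => ∃ m ∈ Finset.Ico k n,
          ∃ S ∈ Finset.powersetCard m Finset.univ, ClosedOutside k S G) := by
        refine erProb_mono fun G => ?_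
        rintro ⟨S, -, h1, h2, h3⟩
        refine ⟨S.ncard, by simp [h1, h2], S.toFinset, ?_, ?_⟩
        · simp [Set.ncard_eq_toFinset_card']
        · intro v hv
          simpa using h3 v (by simpa using hv)
    _ ≤ ∑ m ∈ Finset.Ico k n, erProb n q
          (fun G => ∃ S ∈ Finset.powersetCard m Finset.univ, ClosedOutside k S G) :=
        erProb_exists_mem_le _ _
    _ ≤ _ := by
        refine Finset.sum_le_sum fun m _ => ?_
        refine (erProb_exists_mem_le _ _).trans (le_of_eq ?_)
        rw [Finset.sum_congr rfl fun S hS => by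
          rw [erProb_closedOutside, (Finset.mem_powersetCard.1 hS).2]]
        simp

lemma lowerTail_self (p : ℝ) (k : ℕ) : lowerTail p k k = 1 - p ^ k := by
  have h : ∀ m k, m < k → lowerTail p m k = 1 := by
    intro m
    induction m with
    | zero => intro k hk; cases k with
      | zero => omega
      | succ k => rfl
    | succ m ih => intro k hk; cases k with
      | zero => omega
      | succ k => rw [lowerTail_succ_succ, ih k (by omega), ih (k + 1) (by omega)]; ring
  induction k with
  | zero => simp
  | succ k ih => rw [lowerTail_succ_succ, ih, h k (k + 1) (by omega)]; ring

lemma linksTo_lt_card_iff (G : SimpleGraph (Fin n)) (v : Fin n) (S : Finset (Fin n)) :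
    linksTo G v S < S.card ↔ ¬ ∀ e ∈ starLinks v S, e ∈ G.edgeSet := by
  classical
  rw [linksTo_eq_card, ← card_starLinks v S]
  have h := Finset.card_filter_eq_iff (s := starLinks v S) (p := fun e => e ∈ G.edgeSet)
  have h' := Finset.card_filter_le (starLinks v S) (fun e => e ∈ G.edgeSet)
  rw [← h]
  omega

/-- Inclusion–exclusion: being joined to all of `S` and all of `T` takes at least `k + 1` links, as
`S ≠ T`. -/
lemma erProb_linksTo_lt_and_linksTo_lt {k : ℕ} {v : Fin n} {S T : Finset (Fin n)}
    (hS : S.card = k) (hT : T.card = k) (hST : S ≠ T) (hv : v ∉ S ∪ T) :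
    erProb n q (fun G => linksTo G v S < k ∧ linksTo G v T < k) ≤
      1 - 2 * (q : ℝ) ^ k + (q : ℝ) ^ (k + 1) := by
  classical
  have hvS : v ∉ S := fun h => hv (by simp [h])
  have hvT : v ∉ T := fun h => hv (by simp [h])
  have hS' : ∀ G : SimpleGraph (Fin n), linksTo G v S < k ↔ ¬ ∀ e ∈ starLinks v S, e ∈ G.edgeSet :=
    fun G => hS ▸ linksTo_lt_card_iff G v S
  have hT' : ∀ G : SimpleGraph (Fin n), linksTo G v T < k ↔ ¬ ∀ e ∈ starLinks v T, e ∈ G.edgeSet :=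
    fun G => hT ▸ linksTo_lt_card_iff G v T
  set A : SimpleGraph (Fin n) → Prop := fun G => ∀ e ∈ starLinks v S, e ∈ G.edgeSet with hA
  set B : SimpleGraph (Fin n) → Prop := fun G => ∀ e ∈ starLinks v T, e ∈ G.edgeSet with hB
  simp only [hS', hT']
  have eA : erProb n q A = (q : ℝ) ^ k := by
    rw [hA, erProb_forall_link _ (not_isDiag_of_mem_starLinks hvS), card_starLinks, hS]
  have eB : erProb n q B = (q : ℝ) ^ k := by
    rw [hB, erProb_forall_link _ (not_isDiag_of_mem_starLinks hvT), card_starLinks, hT]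
  have eAB : erProb n q (fun G => B G ∧ A G) = (q : ℝ) ^ (S ∪ T).card := by
    have : ∀ G, (B G ∧ A G) ↔ ∀ e ∈ starLinks v (S ∪ T), e ∈ G.edgeSet := by
      intro G
      simp only [hA, hB, starLinks, Finset.image_union, Finset.forall_mem_union]
      tauto
    simp only [this]
    rw [erProb_forall_link _ (not_isDiag_of_mem_starLinks hv), card_starLinks]
  have h1 : erProb n q (fun G => ¬ A G ∧ ¬ B G) =
      1 - erProb n q (fun G => A G ∨ (B G ∧ ¬ A G)) := by
    rw [← erProb_not]
    congr 1; funext G; exact propext (by tauto)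
  have h2 : erProb n q B = erProb n q (fun G => B G ∧ A G) +
      erProb n q (fun G => B G ∧ ¬ A G) := by
    rw [← erProb_or_of_disjoint (by tauto)]
    congr 1; funext G; exact propext (by tauto)
  rw [erProb_or_of_disjoint (by tauto)] at h1
  have hc : k + 1 ≤ (S ∪ T).card := by
    have : S ⊂ S ∪ T := by
      refine ⟨Finset.subset_union_left, fun h => hST ?_⟩
      exact (Finset.eq_of_subset_of_card_le (Finset.union_subset_iff.1 h).2 (by omega)).symm
    have := Finset.card_lt_card this
    omega
  have hpow : (q : ℝ) ^ (S ∪ T).card ≤ (q : ℝ) ^ (k + 1) :=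
    pow_le_pow_of_le_one q.2.1 q.2.2 hc
  rw [h1]
  linarith

/-- With `q ^ k ≤ q`, the expression `1 - q ^ k * (2 - q)` is at least `(1 - q) ^ 2`. -/
lemma one_sub_two_mul_pow_add_pow_nonneg {k : ℕ} (hk : 1 ≤ k) (q : unitInterval) :
    0 ≤ 1 - 2 * (q : ℝ) ^ k + (q : ℝ) ^ (k + 1) := by
  have h1 : (q : ℝ) ^ k ≤ q := pow_le_of_le_one q.2.1 q.2.2 (by omega)
  have h2 := mul_le_mul_of_nonneg_right h1 (show (0 : ℝ) ≤ 2 - q by linarith [q.2.2])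
  rw [pow_succ]
  nlinarith [sq_nonneg (1 - (q : ℝ))]

/-- Only the nodes outside `S ∪ T` are kept, at least `n - 2 * k` of them; their stars to `S ∪ T`
are disjoint. The bound is uniform in the overlap of `S` and `T`. -/
lemma erProb_closedOutside_and_le {k : ℕ} (hk : 1 ≤ k) {S T : Finset (Fin n)}
    (hS : S.card = k) (hT : T.card = k) (hST : S ≠ T) :
    erProb n q (fun G => ClosedOutside k S G ∧ ClosedOutside k T G) ≤
      (1 - 2 * (q : ℝ) ^ k + (q : ℝ) ^ (k + 1)) ^ (n - 2 * k) := by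
  classical
  set b := 1 - 2 * (q : ℝ) ^ k + (q : ℝ) ^ (k + 1) with hb
  have hb1 : b ≤ 1 := by
    have h1 : (q : ℝ) ^ (k + 1) ≤ q ^ k := pow_le_pow_of_le_one q.2.1 q.2.2 (by omega)
    have h2 : (0 : ℝ) ≤ q ^ k := pow_nonneg q.2.1 k
    rw [hb]; linarith
  have hb0 : 0 ≤ b := one_sub_two_mul_pow_add_pow_nonneg hk q
  calc _ ≤ erProb n q (fun G => ∀ v ∈ (S ∪ T)ᶜ, linksTo G v S < k ∧ linksTo G v T < k) := by
        refine erProb_mono fun G ⟨h1, h2⟩ v hv => ?_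
        simp only [Finset.compl_union, Finset.mem_inter] at hv
        exact ⟨h1 v hv.1, h2 v hv.2⟩
    _ = ∏ v ∈ (S ∪ T)ᶜ, erProb n q (fun G => linksTo G v S < k ∧ linksTo G v T < k) := by
        refine erProb_forall_mem _ (fun v => starLinks v (S ∪ T)) _ (fun v _ => ?_)
          (pairwiseDisjoint_starLinks _)
        refine ((dependsOnLinks_linksTo_lt v S k).mono ?_).and
          ((dependsOnLinks_linksTo_lt v T k).mono ?_)
        · exact Finset.image_subset_image Finset.subset_union_left
        · exact Finset.image_subset_image Finset.subset_union_right
    _ ≤ ∏ v ∈ (S ∪ T)ᶜ, b :=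
        Finset.prod_le_prod (fun _ _ => erProb_nonneg _) fun v hv =>
          erProb_linksTo_lt_and_linksTo_lt hS hT hST (Finset.mem_compl.1 hv)
    _ ≤ b ^ (n - 2 * k) := by
        rw [Finset.prod_const, Finset.card_compl, Fintype.card_fin]
        refine pow_le_pow_of_le_one hb0 hb1 ?_
        have := Finset.card_union_le S T
        omega

/-- The second moment bound for the probability that there is no `k`-closed set of `k` nodes. -/
lemma erProb_forall_not_closedOutside_mul_le {k : ℕ} (hk : 1 ≤ k) {E : ℝ}
    (hE : E = n.choose k * (1 - (q : ℝ) ^ k) ^ (n - k)) :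
    erProb n q (fun G => ∀ S ∈ Finset.powersetCard k Finset.univ, ¬ ClosedOutside k S G) * E ^ 2 ≤
      E + (n.choose k : ℝ) ^ 2 * (1 - 2 * (q : ℝ) ^ k + (q : ℝ) ^ (k + 1)) ^ (n - 2 * k)
        - E ^ 2 := by
  classical
  set b := (1 - 2 * (q : ℝ) ^ k + (q : ℝ) ^ (k + 1)) ^ (n - 2 * k) with hb
  set s : Finset (Finset (Fin n)) := Finset.powersetCard k Finset.univ with hs
  have hcard : ∀ S ∈ s, S.card = k := fun S hS => (Finset.mem_powersetCard.1 hS).2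
  have hsc : s.card = n.choose k := by simp [hs]
  have hE' : ∑ S ∈ s, erProb n q (ClosedOutside k S) = E := by
    rw [hE, Finset.sum_congr rfl fun S hS => by
      rw [erProb_closedOutside, hcard S hS, lowerTail_self], Finset.sum_const, hsc, nsmul_eq_mul]
  have h := erProb_forall_not_mul_sq_le (q := q) s (fun S => ClosedOutside k S)
  rw [hE'] at h
  refine h.trans (sub_le_sub_right ?_ _)
  have hb0 : 0 ≤ b := pow_nonneg (one_sub_two_mul_pow_add_pow_nonneg hk q) _
  calc ∑ S ∈ s, ∑ T ∈ s, erProb n q (fun G => ClosedOutside k S G ∧ ClosedOutside k T G)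
      ≤ ∑ S ∈ s, (erProb n q (ClosedOutside k S) + (s.card - 1 : ℕ) * b) := by
        refine Finset.sum_le_sum fun S hS => ?_
        rw [← Finset.add_sum_erase s _ hS]
        simp only [and_self]
        refine add_le_add le_rfl ?_
        rw [← Finset.card_erase_of_mem hS, ← nsmul_eq_mul]
        refine Finset.sum_le_card_nsmul _ _ _ fun T hT => ?_
        exact erProb_closedOutside_and_le hk (hcard S hS) (hcard T (Finset.mem_of_mem_erase hT))
          (Finset.ne_of_mem_erase hT).symm
    _ = E + (s.card : ℝ) * (s.card - 1 : ℕ) * b := by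
        rw [Finset.sum_add_distrib, hE', Finset.sum_const, nsmul_eq_mul, mul_assoc]
    _ ≤ _ := by
        rw [← hsc]
        have : (s.card : ℝ) * (s.card - 1 : ℕ) ≤ (s.card : ℝ) ^ 2 := by
          rw [sq]; gcongr; omega
        gcongr

end Events

end NetworkCores

/-! ### Cores and conventions yield closed sets. -/

section Deterministic

namespace NetworkCores

open SimpleGraph

variable {n k : ℕ} {G : SimpleGraph (Fin n)}

lemma IsProperConvention.isKClosedSet {S : Set (Fin n)} (h : IsProperConvention G k S) :
    IsKClosedSet G k S := by
  obtain ⟨hne, hlt, hin, hout⟩ := h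
  refine ⟨hne, ?_, hlt, hout⟩
  obtain ⟨v, hv⟩ := hne
  exact (hin v hv).trans (Set.ncard_le_ncard (fun w hw => hw.1) S.toFinite)

lemma IsWeakKCore.isKClosedSet {H : G.Subgraph} (h : IsWeakKCore k H) :
    IsKClosedSet G k H.verts := by
  obtain ⟨hne, hlt, hin, hout⟩ := h
  refine ⟨hne, ?_, hlt, hout⟩
  obtain ⟨v, hv⟩ := hne
  exact (hin v hv).trans (Set.ncard_le_ncard (H.neighborSet_subset_verts v) H.verts.toFinite)

lemma IsKCore.isWeakKCore {H : G.Subgraph} (h : IsKCore k H) : IsWeakKCore k H := by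
  obtain ⟨hne, hlt, hin, hmax⟩ := h
  refine ⟨hne, hlt, hin, fun v hv => ?_⟩
  by_contra! hk
  -- A node with `k` links to the core could be added to it without lowering any degree, against
  -- maximality.
  let H' : G.Subgraph := (⊤ : G.Subgraph).induce (insert v H.verts)
  have hle : H ≤ H' := by
    refine ⟨fun w hw => Set.mem_insert_of_mem _ hw, fun a b hab => ?_⟩
    exact ⟨Set.mem_insert_of_mem _ hab.fst_mem, Set.mem_insert_of_mem _ hab.snd_mem, hab.adj_sub⟩
  have hH' : HasMinDegree k H' := by
    intro w hw
    rcases hw with rfl | hw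
    · refine hk.trans (Set.ncard_le_ncard ?_ (Set.toFinite _))
      intro u hu
      exact ⟨Set.mem_insert _ _, Set.mem_insert_of_mem _ hu.1, hu.2⟩
    · refine (hin w hw).trans (Set.ncard_le_ncard ?_ (Set.toFinite _))
      intro u hu
      exact hle.2 hu
  exact hv ((hmax hH' hle).1 (Set.mem_insert v _))

end NetworkCores

end Deterministic

/-! ### Bounds on the terms of the union bound, by range of `m`. -/

section Estimates

open Real

variable {k m n : ℕ} {p δ ε η F x : ℝ}

lemma choose_mul_pow_le_of_le_exp (hn : 1 ≤ n) (hmn : m ≤ n) (hF0 : 0 ≤ F) (hF : F ≤ exp (-x))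
    (hx : (1 + η) * (m * log n) ≤ x * (n - m)) :
    (n.choose m : ℝ) * F ^ (n - m) ≤ exp (-(η * log n)) ^ m := by
  have hn0 : (0 : ℝ) < n := by exact_mod_cast hn
  have h1 : (n.choose m : ℝ) ≤ exp (m * log n) := by
    rw [exp_nat_mul, exp_log hn0]
    exact_mod_cast Nat.choose_le_pow n m
  have h2 : F ^ (n - m) ≤ exp (-(x * (n - m))) := by
    calc F ^ (n - m) ≤ exp (-x) ^ (n - m) := by gcongr
      _ = _ := by rw [← exp_nat_mul, Nat.cast_sub hmn]; ring_nf
  calc _ ≤ exp (m * log n) * exp (-(x * (n - m))) := by gcongr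
    _ ≤ _ := by
      rw [← exp_add, ← exp_nat_mul, exp_le_exp]
      linarith

/-- From `k * m.choose k = m * (m - 1).choose (k - 1)`. The factor `k` here is the one inside the
threshold: the case `m = k` is the critical one. -/
lemma le_mul_choose (hk : 1 ≤ k) (hkm : k ≤ m) : m ≤ k * m.choose k := by
  obtain ⟨j, rfl⟩ : ∃ j, k = j + 1 := ⟨k - 1, by omega⟩
  obtain ⟨i, rfl⟩ : ∃ i, m = i + 1 := ⟨m - 1, by omega⟩
  have := Nat.add_one_mul_choose_eq i j
  have h2 : 1 ≤ i.choose j := Nat.choose_pos (by omega)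
  nlinarith

lemma lowerTail_term_le_of_small (hk : 1 ≤ k) (hkm : k ≤ m) (hmn : m ≤ n) (hp0 : 0 ≤ p)
    (hp1 : p ≤ 1) (hδ : δ ≤ 1) (hmp : m * p ≤ δ) (hmδ : m ≤ δ * n) (hε : 0 ≤ ε)
    (hη : 1 + η ≤ (1 + ε) * (1 - δ) ^ 2) (hp : (1 + ε) * (k * log n) ≤ p ^ k * n) :
    (n.choose m : ℝ) * lowerTail p m k ^ (n - m) ≤ exp (-(η * log n)) ^ m := by
  have hn1 : (1 : ℝ) ≤ n := by exact_mod_cast hk.trans (hkm.trans hmn)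
  refine choose_mul_pow_le_of_le_exp (x := m.choose k * p ^ k * (1 - δ))
    (hk.trans (hkm.trans hmn)) hmn
    (lowerTail_nonneg hp0 hp1 m k) ?_ ?_
  · calc lowerTail p m k ≤ 1 - m.choose k * p ^ k * (1 - m * p) :=
          lowerTail_le_one_sub_linear hp0 hp1 m k
      _ ≤ 1 - m.choose k * p ^ k * (1 - δ) := by gcongr
      _ ≤ _ := by linarith [add_one_le_exp (-((m.choose k : ℝ) * p ^ k * (1 - δ)))]
  · have hL : 0 ≤ log n := log_nonneg hn1
    have h1 : (m : ℝ) ≤ k * m.choose k := by exact_mod_cast le_mul_choose hk hkm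
    have hd : 0 ≤ 1 - δ := by linarith
    calc (1 + η) * (m * log n) ≤ (1 + ε) * (1 - δ) ^ 2 * (m * log n) := by gcongr
      _ ≤ (1 + ε) * (1 - δ) ^ 2 * ((k * m.choose k) * log n) := by gcongr
      _ = (m.choose k * (1 - δ) ^ 2) * ((1 + ε) * (k * log n)) := by ring
      _ ≤ (m.choose k * (1 - δ) ^ 2) * (p ^ k * n) := by gcongr
      _ = m.choose k * p ^ k * (1 - δ) * (n - δ * n) := by ring
      _ ≤ _ := by gcongr

lemma lowerTail_le_one_sub_const (hk : 1 ≤ k) (hp0 : 0 < p) (hp1 : p ≤ 1) (hδ0 : 0 < δ)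
    (hδ : δ ≤ 1 / 2) (hpδ : 2 * k * p ≤ δ) (hmp : δ < m * p) :
    lowerTail p m k ≤ 1 - (δ / 4) ^ k / k.factorial / 2 := by
  -- The tail decreases in the number of trials, so these are cut down until the mean is just below
  -- `δ`, where the linear bound is still effective.
  set j := ⌊δ / p⌋₊ with hj
  have hk' : (1 : ℝ) ≤ k := by exact_mod_cast hk
  have hj1 : (j : ℝ) * p ≤ δ := by
    rw [← le_div_iff₀ hp0]; exact Nat.floor_le (by positivity)
  have hj2 : δ < (j + 1) * p := by
    rw [← div_lt_iff₀ hp0]; exact Nat.lt_floor_add_one _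
  have hjm : j ≤ m := by
    have : (j : ℝ) < m := lt_of_mul_lt_mul_right (hj1.trans_lt hmp) hp0.le
    exact_mod_cast this.le
  have h2k : 2 * k ≤ j := by
    apply Nat.le_floor
    rw [le_div_iff₀ hp0]; exact_mod_cast hpδ
  have hc : (δ / 4) ^ k / k.factorial ≤ j.choose k * p ^ k := by
    have h1 := Nat.pow_le_choose (α := ℝ) k j
    have h2 : δ / 4 ≤ ((j + 1 - k : ℕ) : ℝ) * p := by
      have h3 : (2 * k : ℝ) ≤ j := by exact_mod_cast h2k
      rw [Nat.cast_sub (by omega)]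
      push_cast
      nlinarith
    calc (δ / 4) ^ k / k.factorial ≤ (((j + 1 - k : ℕ) : ℝ) * p) ^ k / k.factorial := by gcongr
      _ = ((j + 1 - k : ℕ) : ℝ) ^ k / k.factorial * p ^ k := by rw [mul_pow]; ring
      _ ≤ _ := by gcongr
  calc lowerTail p m k ≤ lowerTail p j k := lowerTail_anti_left hp0.le hp1 k hjm
    _ ≤ 1 - j.choose k * p ^ k * (1 - j * p) := lowerTail_le_one_sub_linear hp0.le hp1 j k
    _ ≤ 1 - (δ / 4) ^ k / k.factorial * (1 / 2) := by
      gcongr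
      linarith
    _ = _ := by ring

lemma lowerTail_term_le_of_medium {c : ℝ} (hn : 1 ≤ n) (hmn : 2 * m ≤ n) (hp0 : 0 ≤ p)
    (hp1 : p ≤ 1) (hc : 0 ≤ c)
    (hF : lowerTail p m k ≤ 1 - c) (hm : m * log n ≤ c / 4 * n) (hlog : 2 * log n ≤ c / 4 * n) :
    (n.choose m : ℝ) * lowerTail p m k ^ (n - m) ≤ exp (-(2 * log n)) := by
  have hn0 : (0 : ℝ) < n := by exact_mod_cast hn
  have h1 : (n.choose m : ℝ) ≤ exp (m * log n) := by
    rw [exp_nat_mul, exp_log hn0]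
    exact_mod_cast Nat.choose_le_pow n m
  have h2 : lowerTail p m k ^ (n - m) ≤ exp (-(c * (n - m))) := by
    calc lowerTail p m k ^ (n - m) ≤ exp (-c) ^ (n - m) := by
          gcongr
          · exact lowerTail_nonneg hp0 hp1 m k
          · linarith [add_one_le_exp (-c)]
      _ = _ := by rw [← exp_nat_mul, Nat.cast_sub (by omega)]; ring_nf
  have h3 := pow_nonneg (lowerTail_nonneg hp0 hp1 m k) (n - m)
  calc _ ≤ exp (m * log n) * exp (-(c * (n - m))) := by gcongr
    _ ≤ _ := by
      rw [← exp_add, exp_le_exp]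
      have : (2 * m : ℝ) ≤ n := by exact_mod_cast hmn
      nlinarith

lemma lowerTail_term_le_of_large (hmn : m < n) (hp0 : 0 ≤ p) (hp1 : p ≤ 1)
    (h : 3 * log n + k * log 2 ≤ m * p / 2) :
    (n.choose m : ℝ) * lowerTail p m k ^ (n - m) ≤ exp (-(2 * log n)) := by
  have hn0 : (0 : ℝ) < n := by exact_mod_cast (Nat.zero_le m).trans_lt hmn
  have hF0 := lowerTail_nonneg hp0 hp1 m k
  have hL : 0 ≤ log n := log_nonneg (by exact_mod_cast (show 1 ≤ n by omega))
  have h1 : (n.choose m : ℝ) ≤ (n : ℝ) ^ (n - m) := by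
    rw [← Nat.choose_symm hmn.le]
    exact_mod_cast Nat.choose_le_pow n (n - m)
  have h2 : n * lowerTail p m k ≤ exp (-(2 * log n)) := by
    calc n * lowerTail p m k ≤ exp (log n) * (2 ^ k * exp (-(m * p / 2))) := by
          rw [exp_log hn0]
          gcongr
          exact lowerTail_le_exp hp0 hp1 m k
      _ = exp (log n + (k * log 2 + -(m * p / 2))) := by
          rw [exp_add, exp_add, exp_nat_mul, exp_log two_pos]
      _ ≤ _ := by
          rw [exp_le_exp]; linarith
  calc _ ≤ (n : ℝ) ^ (n - m) * lowerTail p m k ^ (n - m) := by gcongr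
    _ = (n * lowerTail p m k) ^ (n - m) := by rw [mul_pow]
    _ ≤ n * lowerTail p m k := by
      -- The base is at most 1 and `n - m ≥ 1`, so a single factor suffices.
      refine pow_le_of_le_one (by positivity) (h2.trans ?_) (by omega)
      rw [exp_le_one_iff]; linarith
    _ ≤ _ := h2

lemma lowerTail_one_term_le (hn : 1 ≤ n) (hm1 : 1 ≤ m) (hmn : m < n) (hp0 : 0 ≤ p) (hp1 : p ≤ 1)
    (hδ0 : 0 < δ) (hδ : δ ≤ 1 / 2) (hε : 0 ≤ ε)
    (hη : 1 + η ≤ (1 + ε) * (1 - δ) ^ 2) (hp : (1 + ε) * log n ≤ p * n)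
    (hlog : 3 ≤ δ / 2 * log n) :
    (n.choose m : ℝ) * lowerTail p m 1 ^ (n - m) ≤
      exp (-(η * log n)) ^ m + exp (-(η * log n)) ^ (n - m) + exp (-(2 * log n)) := by
  have hn0 : (0 : ℝ) < n := by exact_mod_cast hn
  have hL : 0 ≤ log n := log_nonneg (by exact_mod_cast hn)
  set r := exp (-(η * log n)) with hr
  have hr0 : 0 ≤ r := (exp_pos _).le
  have hη' : 1 + η ≤ (1 + ε) * (1 - δ) := hη.trans <| by
    have : (1 - δ) ^ 2 ≤ 1 - δ := pow_le_of_le_one (by linarith) (by linarith) two_ne_zero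
    gcongr
  have hmain : ∀ j : ℕ, (j : ℝ) ≤ δ * n →
      (1 + η) * (j * log n) ≤ p * j * (n - j) := by
    intro j hj
    calc (1 + η) * (j * log n) ≤ (1 + ε) * (1 - δ) * (j * log n) := by gcongr
      _ = (1 - δ) * j * ((1 + ε) * log n) := by ring
      _ ≤ (1 - δ) * j * (p * n) := by
          have : 0 ≤ 1 - δ := by linarith
          gcongr
      _ = p * j * (n - δ * n) := by ring
      _ ≤ _ := by gcongr
  have hF : ∀ j : ℕ, (1 - p) ^ j ≤ exp (-(p * j)) := by
    intro j
    calc (1 - p) ^ j ≤ exp (-p) ^ j := by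
          refine pow_le_pow_left₀ (by linarith) ?_ j
          linarith [add_one_le_exp (-p)]
      _ = _ := by rw [← exp_nat_mul]; ring_nf
  have hq : ∀ j : ℕ, 0 ≤ (1 - p) ^ j := fun j => pow_nonneg (by linarith) j
  rw [lowerTail_one_right]
  by_cases h1 : (m : ℝ) ≤ δ * n
  · have := choose_mul_pow_le_of_le_exp hn hmn.le (hq m) (hF m) (hmain m h1)
    have := pow_nonneg hr0 (n - m)
    have := exp_pos (-(2 * log n))
    linarith
  by_cases h2 : ((n - m : ℕ) : ℝ) ≤ δ * n
  · have h := choose_mul_pow_le_of_le_exp hn (Nat.sub_le n m) (hq (n - m)) (hF (n - m))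
      (hmain (n - m) h2)
    rw [Nat.choose_symm hmn.le, ← pow_mul, show n - (n - m) = m by omega, mul_comm (n - m),
      pow_mul] at h
    have := pow_nonneg hr0 m
    have := exp_pos (-(2 * log n))
    linarith
  · have h3 : (n.choose m : ℝ) * ((1 - p) ^ m) ^ (n - m) ≤ exp (-(2 * log n)) := by
      have h4 : (n.choose m : ℝ) ≤ exp (n * log 2) := by
        rw [exp_nat_mul, exp_log two_pos]
        exact_mod_cast Nat.choose_le_two_pow n m
      have h5 : ((1 - p) ^ m) ^ (n - m) ≤ exp (-(p * m * (n - m))) := by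
        calc _ ≤ exp (-(p * m)) ^ (n - m) := by
              exact pow_le_pow_left₀ (hq m) (hF m) _
          _ = _ := by rw [← exp_nat_mul, Nat.cast_sub hmn.le]; ring_nf
      -- Both parts exceed `δ * n`, so there are quadratically many cross pairs, enough to beat `2 ^
      -- n`.
      have h6 : δ / 2 * n ^ 2 ≤ m * ((n : ℝ) - m) := by
        rw [Nat.cast_sub hmn.le] at h2
        push Not at h1 h2
        have e1 := mul_nonneg (sub_nonneg.2 h1.le) (sub_nonneg.2 h2.le)
        have e2 : 0 ≤ δ * n ^ 2 * (1 / 2 - δ) :=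
          mul_nonneg (by positivity) (by linarith)
        nlinarith
      have h7 : log n ≤ p * n := by nlinarith
      have h8 : 3 * n ≤ p * m * (n - m) := by
        calc 3 * (n : ℝ) ≤ δ / 2 * log n * n := by gcongr
          _ ≤ δ / 2 * (p * n) * n := by gcongr
          _ = p * (δ / 2 * n ^ 2) := by ring
          _ ≤ p * (m * ((n : ℝ) - m)) := by gcongr
          _ = _ := by ring
      have h9 : log n ≤ n := (log_le_sub_one_of_pos hn0).trans (by linarith)
      calc _ ≤ exp (n * log 2) * exp (-(p * m * (n - m))) := by gcongr
        _ ≤ _ := by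
          rw [← exp_add, exp_le_exp]
          have : log 2 ≤ 1 := by linarith [log_two_lt_d9]
          nlinarith
    have := pow_nonneg hr0 m
    have := pow_nonneg hr0 (n - m)
    linarith

lemma sum_Ico_geom_bound_le {r e : ℝ} (hk : 1 ≤ k) (hr0 : 0 ≤ r) (hr1 : r < 1) (he : 0 ≤ e) :
    ∑ m ∈ Finset.Ico k n, (r ^ m + r ^ (n - m) + e) ≤ 2 * (r / (1 - r)) + n * e := by
  have hgeom : ∀ j, ∑ m ∈ Finset.Ico 1 j, r ^ m ≤ r / (1 - r) := fun j => by
    simpa using geom_sum_Ico_le_of_lt_one (m := 1) (n := j) hr0 hr1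
  have h1 : ∑ m ∈ Finset.Ico k n, r ^ m ≤ r / (1 - r) :=
    (Finset.sum_le_sum_of_subset_of_nonneg (Finset.Ico_subset_Ico_left hk)
      fun _ _ _ => pow_nonneg hr0 _).trans (hgeom n)
  have h2 : ∑ m ∈ Finset.Ico k n, r ^ (n - m) ≤ r / (1 - r) := by
    rw [Finset.sum_Ico_reflect (fun m => r ^ m) k (Nat.le_succ n), Nat.add_sub_cancel_left]
    exact hgeom _
  have h3 : ∑ m ∈ Finset.Ico k n, e ≤ n * e := by
    rw [Finset.sum_const, nsmul_eq_mul, Nat.card_Ico]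
    gcongr
    omega
  rw [Finset.sum_add_distrib, Finset.sum_add_distrib]
  linarith

end Estimates

/-! ### The limit above the threshold. -/

section Asymptotics

open Real NetworkCores

lemma eventually_mul_log_pow_le (C : ℝ) (j : ℕ) :
    ∀ᶠ n : ℕ in atTop, C * log n ^ j ≤ n := by
  have h := (isLittleO_pow_log_id_atTop (n := j)).comp_tendsto tendsto_natCast_atTop_atTop
  have h' := h.bound (show (0 : ℝ) < (|C| + 1)⁻¹ by positivity)
  filter_upwards [h'] with n hn
  simp only [Function.comp_apply, id, norm_eq_abs, Nat.abs_cast] at hn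
  rw [inv_mul_eq_div, le_div_iff₀ (by positivity)] at hn
  calc C * log n ^ j ≤ |C * log n ^ j| := le_abs_self _
    _ = |log n ^ j| * |C| := by rw [abs_mul, mul_comm]
    _ ≤ |log n ^ j| * (|C| + 1) := by gcongr; linarith
    _ ≤ n := hn

lemma tendsto_log_natCast : Tendsto (fun n : ℕ => log n) atTop atTop :=
  tendsto_log_atTop.comp tendsto_natCast_atTop_atTop

lemma tendsto_exp_neg_mul_log {c : ℝ} (hc : 0 < c) :
    Tendsto (fun n : ℕ => exp (-(c * log n))) atTop (𝓝 0) :=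
  tendsto_exp_neg_atTop_nhds_zero.comp (tendsto_log_natCast.const_mul_atTop hc)

lemma eventually_lowerTail_term_le {k : ℕ} (hk : 1 ≤ k) {ε : ℝ} (hε : 0 < ε) (hε1 : ε ≤ 1)
    {p : ℕ → ℝ} (h0 : ∀ᶠ n in atTop, 0 ≤ p n) (hp : Tendsto p atTop (𝓝 0))
    (h : ∀ᶠ n : ℕ in atTop, (1 + ε) * (k * log n) ≤ p n ^ k * n) :
    ∀ᶠ n : ℕ in atTop, ∀ m ∈ Finset.Ico k n,
      (n.choose m : ℝ) * lowerTail (p n) m k ^ (n - m) ≤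
        exp (-(ε / 2 * log n)) ^ m + exp (-(ε / 2 * log n)) ^ (n - m) + exp (-(2 * log n)) := by
  -- Small enough that `(1 + ε) * (1 - δ) ^ 2` keeps a margin `ε / 2` over 1; this uses `ε ≤ 1`.
  obtain ⟨δ, hδ⟩ : ∃ δ, δ = ε / 8 := ⟨_, rfl⟩
  have hδ0 : 0 < δ := by rw [hδ]; positivity
  have hδ2 : δ ≤ 1 / 2 := by rw [hδ]; linarith
  have hη : 1 + ε / 2 ≤ (1 + ε) * (1 - δ) ^ 2 := by
    rw [hδ]
    nlinarith [mul_nonneg hε.le (sub_nonneg.2 hε1), mul_nonneg (sq_nonneg ε) (by linarith : 0 ≤ 1 + ε)]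
  have hp1 : ∀ᶠ n in atTop, p n ≤ 1 := hp.eventually_le_const one_pos
  rcases hk.eq_or_lt with rfl | hk2
  · filter_upwards [h0, hp1, h, eventually_ge_atTop 1,
      tendsto_log_natCast.eventually_ge_atTop (3 / (δ / 2))] with n h0 hp1 h hn hlog m hm
    rw [Finset.mem_Ico] at hm
    refine lowerTail_one_term_le hn hm.1 hm.2 h0 hp1 hδ0 hδ2 hε.le hη (by simpa using h) ?_
    rwa [div_le_iff₀' (by positivity)] at hlog
  · obtain ⟨c, hc⟩ : ∃ c : ℝ, c = (δ / 4) ^ k / k.factorial / 2 := ⟨_, rfl⟩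
    have hc0 : 0 < c := by rw [hc]; positivity
    have hc1 : c ≤ 1 := by
      have h1 : (δ / 4) ^ k ≤ 1 := pow_le_one₀ (by positivity) (by linarith)
      have h2 : (1 : ℝ) ≤ k.factorial := by exact_mod_cast Nat.one_le_iff_ne_zero.2 k.factorial_ne_zero
      rw [hc, div_div]
      exact (div_le_one₀ (by positivity)).2 (by linarith)
    have hk' : (1 : ℝ) ≤ k := by exact_mod_cast hk
    have hp2 : ∀ᶠ n in atTop, p n ≤ δ / (2 * k) := hp.eventually_le_const (by positivity)
    set C : ℝ := 2 * (3 + k) / (c / 4) with hC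
    have hC0 : 0 ≤ C := by positivity
    filter_upwards [h0, hp1, hp2, h, eventually_ge_atTop 1,
      tendsto_log_natCast.eventually_ge_atTop 1, eventually_mul_log_pow_le (C ^ 2) 4,
      eventually_mul_log_pow_le (2 / (c / 4)) 1]
      with n h0 hp1 hp2 h hn hlog hC4 hc2 m hm
    rw [Finset.mem_Ico] at hm
    have hn0 : (0 : ℝ) < n := by exact_mod_cast hn
    have hkn : 1 ≤ p n ^ k * n := by
      refine le_trans ?_ h
      nlinarith [mul_le_mul hk' hlog zero_le_one (by positivity)]
    -- Here `k ≥ 2` is essential: the mean degree is at least `√n`, hence beats `log n ^ 2`. For `k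
    -- = 1` it may be only of order `log n`.
    have hpn2 : (n : ℝ) ≤ (p n * n) ^ 2 := by
      have : p n ^ k ≤ p n ^ 2 := pow_le_pow_of_le_one h0 hp1 hk2
      have h3 : 1 ≤ p n ^ 2 * n := hkn.trans (by gcongr)
      nlinarith
    have hpn1 : 1 ≤ p n * n := by
      refine hkn.trans ?_
      gcongr
      exact pow_le_of_le_one h0 hp1 (by omega)
    have hpC : C * log n ^ 2 ≤ p n * n := by
      refine le_of_pow_le_pow_left₀ two_ne_zero (by positivity) (le_trans (le_of_eq ?_) (hC4.trans hpn2))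
      ring
    have e1 : 0 ≤ exp (-(ε / 2 * log n)) ^ m := by positivity
    have e2 : 0 ≤ exp (-(ε / 2 * log n)) ^ (n - m) := by positivity
    have e3 : 0 ≤ exp (-(2 * log n)) := by positivity
    by_cases h1 : m * p n ≤ δ
    · have hm' : (m : ℝ) ≤ δ * n := by
        calc (m : ℝ) ≤ m * (p n * n) := le_mul_of_one_le_right (Nat.cast_nonneg m) hpn1
          _ = m * p n * n := by ring
          _ ≤ δ * n := by gcongr
      have := lowerTail_term_le_of_small hk hm.1 hm.2.le h0 hp1 (by linarith) h1 hm' hε.le hη h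
      linarith
    push Not at h1
    have hp0 : 0 < p n := h0.lt_of_ne fun h => by rw [← h, mul_zero] at h1; linarith
    by_cases h2 : m * log n ≤ c / 4 * n
    · have hF := lowerTail_le_one_sub_const hk hp0 hp1 hδ0 hδ2
        (by rwa [le_div_iff₀' (by positivity)] at hp2) h1
      rw [← hc] at hF
      have hmn : 2 * m ≤ n := by
        have : (2 * m : ℝ) ≤ n := by nlinarith
        exact_mod_cast this
      have hl : 2 * log n ≤ c / 4 * n := by
        rw [pow_one, div_mul_eq_mul_div, div_le_iff₀' (by positivity)] at hc2
        exact hc2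
      have := lowerTail_term_le_of_medium hn hmn h0 hp1 hc0.le hF h2 hl
      linarith
    · push Not at h2
      have h3 : 3 * log n + k * log 2 ≤ m * p n / 2 := by
        have hl2 : log 2 ≤ 1 := by linarith [log_two_lt_d9]
        have h4 : 3 * log n + k * log 2 ≤ (3 + k) * log n := by
          have : (k : ℝ) * log 2 ≤ k * log n :=
            mul_le_mul_of_nonneg_left (hl2.trans hlog) (Nat.cast_nonneg k)
          linarith
        refine h4.trans ?_
        have h5 : (3 + k) * log n * (2 * log n) ≤ m * p n / 2 * (2 * log n) := by
          calc (3 + k) * log n * (2 * log n) = c / 4 * (C * log n ^ 2) := by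
                rw [hC]; field_simp
            _ ≤ c / 4 * (p n * n) := by gcongr
            _ = c / 4 * n * p n := by ring
            _ ≤ m * log n * p n := by gcongr
            _ = _ := by ring
        exact le_of_mul_le_mul_right h5 (by linarith)
      have := lowerTail_term_le_of_large hm.2 h0 hp1 h3
      linarith

lemma tendsto_sum_lowerTail_terms {k : ℕ} (hk : 1 ≤ k) {ε : ℝ} (hε : 0 < ε) (hε1 : ε ≤ 1)
    {p : ℕ → ℝ} (h0 : ∀ᶠ n in atTop, 0 ≤ p n) (hp : Tendsto p atTop (𝓝 0))
    (h : ∀ᶠ n : ℕ in atTop, (1 + ε) * (k * log n) ≤ p n ^ k * n) :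
    Tendsto (fun n : ℕ => ∑ m ∈ Finset.Ico k n,
      (n.choose m : ℝ) * lowerTail (p n) m k ^ (n - m)) atTop (𝓝 0) := by
  have hr : Tendsto (fun n : ℕ => exp (-(ε / 2 * log n))) atTop (𝓝 0) :=
    tendsto_exp_neg_mul_log (by positivity)
  have hn : Tendsto (fun n : ℕ => n * exp (-(2 * log n))) atTop (𝓝 0) := by
    refine (tendsto_exp_neg_mul_log one_pos).congr' ?_
    filter_upwards [eventually_ge_atTop 1] with n hn
    have hn0 : (0 : ℝ) < n := by exact_mod_cast hn
    nth_rw 2 [← exp_log hn0]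
    rw [← exp_add]
    ring_nf
  have hlim : Tendsto (fun n : ℕ => 2 * (exp (-(ε / 2 * log n)) / (1 - exp (-(ε / 2 * log n)))) +
      n * exp (-(2 * log n))) atTop (𝓝 0) := by
    have := ((hr.div (tendsto_const_nhds.sub hr) (by norm_num)).const_mul (2 : ℝ)).add hn
      (f := fun n : ℕ => 2 * (exp (-(ε / 2 * log n)) / (1 - exp (-(ε / 2 * log n)))))
    simpa using this
  refine tendsto_of_tendsto_of_tendsto_of_le_of_le' tendsto_const_nhds hlim ?_ ?_
  · filter_upwards [h0, hp.eventually_le_const one_pos] with n h0 h1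
    exact Finset.sum_nonneg fun m _ =>
      mul_nonneg (Nat.cast_nonneg _) (pow_nonneg (lowerTail_nonneg h0 h1 m k) _)
  · filter_upwards [eventually_lowerTail_term_le hk hε hε1 h0 hp h,
      hr.eventually_lt_const one_pos] with n hterm hr1
    exact (Finset.sum_le_sum hterm).trans
      (sum_Ico_geom_bound_le hk (exp_pos _).le hr1 (exp_pos _).le)

lemma coreThreshold_nonneg (k n : ℕ) : 0 ≤ coreThreshold k n := by
  unfold coreThreshold
  have := log_natCast_nonneg n
  positivity

lemma coreThreshold_pow {k : ℕ} (hk : 1 ≤ k) (n : ℕ) :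
    coreThreshold k n ^ k = k * log n / n := by
  have := log_natCast_nonneg n
  rw [coreThreshold, one_div, rpow_inv_natCast_pow (by positivity) (by omega)]

lemma coreThreshold_pow_mul {k n : ℕ} (hk : 1 ≤ k) (hn : 1 ≤ n) :
    coreThreshold k n ^ k * n = k * log n := by
  have : (n : ℝ) ≠ 0 := by positivity
  rw [coreThreshold_pow hk, div_mul_cancel₀ _ this]

lemma tendsto_log_pow_div_natCast (j : ℕ) :
    Tendsto (fun n : ℕ => log n ^ j / n) atTop (𝓝 0) :=
  (isLittleO_pow_log_id_atTop (n := j)).tendsto_div_nhds_zero.comp tendsto_natCast_atTop_atTop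

lemma tendsto_zero_of_pow {α : Type*} {l : Filter α} {f : α → ℝ} {k : ℕ} (hk : 1 ≤ k)
    (hf : ∀ a, 0 ≤ f a) (h : Tendsto (fun a => f a ^ k) l (𝓝 0)) : Tendsto f l (𝓝 0) := by
  have hk0 : (0 : ℝ) < (k : ℝ)⁻¹ := by positivity
  have := h.rpow_const (p := (k : ℝ)⁻¹) (Or.inr hk0.le)
  rw [zero_rpow hk0.ne'] at this
  refine this.congr fun a => ?_
  rw [pow_rpow_inv_natCast (hf a) (by omega)]

lemma tendsto_coreThreshold {k : ℕ} (hk : 1 ≤ k) :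
    Tendsto (coreThreshold k) atTop (𝓝 0) := by
  refine tendsto_zero_of_pow hk (coreThreshold_nonneg k) ?_
  have := (tendsto_log_pow_div_natCast 1).const_mul (k : ℝ)
  rw [mul_zero] at this
  refine this.congr fun n => ?_
  rw [coreThreshold_pow hk]; ring

/-- Used below the threshold, where it makes the correlation exponent `p * p ^ k * n` vanish. -/
lemma tendsto_coreThreshold_mul_log {k : ℕ} (hk : 1 ≤ k) :
    Tendsto (fun n : ℕ => coreThreshold k n * log n) atTop (𝓝 0) := by
  refine tendsto_zero_of_pow hk
    (fun n => mul_nonneg (coreThreshold_nonneg k n) (log_natCast_nonneg n)) ?_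
  have := (tendsto_log_pow_div_natCast (k + 1)).const_mul (k : ℝ)
  rw [mul_zero] at this
  refine this.congr fun n => ?_
  rw [mul_pow, coreThreshold_pow hk]; ring

lemma tendsto_erProb_exists_isKClosedSet {k : ℕ} (hk : 1 ≤ k) {p : ℕ → unitInterval} {ε : ℝ}
    (hε : 0 < ε) (h : ∀ᶠ n : ℕ in atTop, (1 + ε) * coreThreshold k n < (p n : ℝ)) :
    Tendsto (fun n => erProb n (p n) (fun G => ∃ S, IsKClosedSet G k S)) atTop (𝓝 0) := by
  set e := min ε 1 with he
  have he0 : 0 < e := lt_min hε one_pos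
  have hP0 : ∀ n, 0 ≤ (1 + e) * coreThreshold k n := fun n =>
    mul_nonneg (by linarith) (coreThreshold_nonneg k n)
  have hlim := tendsto_sum_lowerTail_terms (p := fun n => (1 + e) * coreThreshold k n) hk he0
    (min_le_right _ _) (.of_forall hP0)
    (by simpa using (tendsto_coreThreshold hk).const_mul (1 + e)) (by
      filter_upwards [eventually_ge_atTop 1] with n hn
      have := log_natCast_nonneg n
      rw [mul_pow, mul_assoc, coreThreshold_pow_mul hk hn]
      gcongr
      exact le_self_pow₀ (by linarith) (by omega))
  refine tendsto_of_tendsto_of_tendsto_of_le_of_le' tendsto_const_nhds hlim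
    (.of_forall fun n => erProb_nonneg _) ?_
  filter_upwards [h] with n hn
  refine (erProb_exists_isKClosedSet_le k).trans (Finset.sum_le_sum fun m _ => ?_)
  have hle : (1 + e) * coreThreshold k n ≤ p n := by
    refine le_trans ?_ hn.le
    have := coreThreshold_nonneg k n
    gcongr
    exact min_le_left _ _
  gcongr
  · exact lowerTail_nonneg (p n).2.1 (p n).2.2 m k
  · exact lowerTail_anti_prob (hP0 n) hle (p n).2.2 m k

end Asymptotics

/-! ### The limit below the threshold, and the theorem. -/

section SecondMoment

open Real NetworkCores

/-- The second moment bound in explicit form. -/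
lemma erProb_forall_not_closedOutside_le {k n : ℕ} (hk : 1 ≤ k) (hkn : 2 * k ≤ n)
    {q : unitInterval} (hq : (q : ℝ) ^ k ≤ 1 / 2) {E : ℝ}
    (hE : E = n.choose k * (1 - (q : ℝ) ^ k) ^ (n - k)) :
    erProb n q (fun G => ∀ S ∈ Finset.powersetCard k Finset.univ, ¬ ClosedOutside k S G) ≤
      1 / E + exp (4 * (q * ((q : ℝ) ^ k * n))) / (1 - (q : ℝ) ^ k) ^ (2 * k) - 1 := by
  have h := erProb_forall_not_closedOutside_mul_le (q := q) hk hE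
  have hb0 := one_sub_two_mul_pow_add_pow_nonneg hk q
  have hq0 : (0 : ℝ) ≤ q := q.2.1
  rw [pow_succ' (q : ℝ) k] at h hb0
  set x := (q : ℝ) ^ k with hx
  have hx0 : 0 ≤ x := by positivity
  have hy : 0 < 1 - x := by linarith
  have hN : (0 : ℝ) < n.choose k := by exact_mod_cast Nat.choose_pos (by omega)
  have hE0 : 0 < E := by rw [hE]; positivity
  have hqx : 0 ≤ q * x := by positivity
  -- Compares the joint factor with the product of the two marginals; the 4 comes from `(1 - x) ^ 2
  -- ≥ 1 / 4`.
  have hb : 1 - 2 * x + q * x ≤ (1 - x) ^ 2 * exp (4 * (q * x)) := by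
    have h1 : 1 + 4 * (q * x) ≤ exp (4 * (q * x)) := by linarith [add_one_le_exp (4 * (q * x))]
    have h2 : 1 / 4 ≤ (1 - x) ^ 2 := by nlinarith
    calc 1 - 2 * x + q * x ≤ (1 - x) ^ 2 + 1 / 4 * (4 * (q * x)) := by nlinarith
      _ ≤ (1 - x) ^ 2 + (1 - x) ^ 2 * (4 * (q * x)) := by gcongr
      _ = (1 - x) ^ 2 * (1 + 4 * (q * x)) := by ring
      _ ≤ _ := by gcongr
  have hpow : (1 - 2 * x + q * x) ^ (n - 2 * k) ≤
      ((1 - x) ^ (n - k)) ^ 2 * (exp (4 * (q * (x * n))) / (1 - x) ^ (2 * k)) := by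
    calc (1 - 2 * x + q * x) ^ (n - 2 * k)
        ≤ ((1 - x) ^ 2 * exp (4 * (q * x))) ^ (n - 2 * k) := by gcongr
      _ = (1 - x) ^ (2 * (n - 2 * k)) * exp (4 * (q * x)) ^ (n - 2 * k) := by
          rw [mul_pow, ← pow_mul]
      _ ≤ (1 - x) ^ (2 * (n - 2 * k)) * exp (4 * (q * (x * n))) := by
          gcongr
          calc exp (4 * (q * x)) ^ (n - 2 * k) ≤ exp (4 * (q * x)) ^ n :=
                pow_le_pow_right₀ (one_le_exp (by positivity)) (Nat.sub_le _ _)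
            _ = _ := by rw [← exp_nat_mul]; ring_nf
      _ = _ := by
          rw [← pow_mul, show (n - k) * 2 = 2 * (n - 2 * k) + 2 * k by omega, pow_add]
          field_simp
  set ρ := exp (4 * (q * (x * n))) / (1 - x) ^ (2 * k) with hρ
  have h2 : (n.choose k : ℝ) ^ 2 * (1 - 2 * x + q * x) ^ (n - 2 * k) ≤ E ^ 2 * ρ := by
    calc _ ≤ (n.choose k : ℝ) ^ 2 * (((1 - x) ^ (n - k)) ^ 2 * ρ) := by gcongr
      _ = _ := by rw [hE]; ring
  refine le_of_mul_le_mul_right (h.trans ?_) (pow_pos hE0 2)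
  calc _ ≤ E + E ^ 2 * ρ - E ^ 2 := by linarith
    _ = _ := by field_simp

/-- For small `x`, `1 - x ≥ exp (-(1 + ε) * x)`, so `(1 - x) ^ n` is at least `n ^ (-(1 - ε ^ 2) *
k)`, against `n.choose k ≥ (n / 2) ^ k / k!`. -/
lemma exp_le_expected_closed {k n : ℕ} {ε x : ℝ} (hkn : 2 * k ≤ n) (hn : 1 ≤ n)
    (hε : 0 < ε) (hx0 : 0 ≤ x) (hx : x ≤ ε / (1 + ε))
    (hxn : x * n ≤ (1 - ε) * (k * log n)) :
    exp (ε ^ 2 * k * log n) / (2 ^ k * k.factorial) ≤ n.choose k * (1 - x) ^ (n - k) := by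
  have hn0 : (0 : ℝ) < n := by exact_mod_cast hn
  rw [le_div_iff₀ (by positivity)] at hx
  have hx1 : x < 1 := by nlinarith
  have hN : (n : ℝ) ^ k / (2 ^ k * k.factorial) ≤ n.choose k := by
    refine le_trans ?_ (Nat.pow_le_choose k n)
    rw [← div_div, ← div_pow]
    gcongr
    rw [Nat.cast_sub (by omega)]
    have : (2 * k : ℝ) ≤ n := by exact_mod_cast hkn
    push_cast
    linarith
  have h1 : exp (-(x * (1 + ε))) ≤ 1 - x := by
    have h2 := add_one_le_exp (x * (1 + ε))
    rw [exp_neg, inv_le_comm₀ (exp_pos _) (by linarith)]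
    refine le_trans ?_ h2
    rw [inv_le_iff_one_le_mul₀ (by linarith)]
    nlinarith [mul_nonneg hx0 (show 0 ≤ ε - x * (1 + ε) by linarith)]
  have h2 : exp (-((1 - ε ^ 2) * (k * log n))) ≤ (1 - x) ^ (n - k) := by
    calc exp (-((1 - ε ^ 2) * (k * log n))) ≤ exp (-(x * (1 + ε))) ^ n := by
          rw [← exp_nat_mul, exp_le_exp]
          have := mul_le_mul_of_nonneg_right hxn (show 0 ≤ 1 + ε by linarith)
          linarith
      _ ≤ (1 - x) ^ n := by gcongr
      _ ≤ _ := pow_le_pow_of_le_one (by linarith) (by linarith) (Nat.sub_le _ _)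
  calc exp (ε ^ 2 * k * log n) / (2 ^ k * k.factorial)
      = (n : ℝ) ^ k / (2 ^ k * k.factorial) * exp (-((1 - ε ^ 2) * (k * log n))) := by
        have : (n : ℝ) ^ k = exp (k * log n) := by rw [exp_nat_mul, exp_log hn0]
        rw [this, div_mul_eq_mul_div, ← exp_add]
        ring_nf
    _ ≤ _ := by gcongr

lemma tendsto_erProb_forall_not_closedOutside {k : ℕ} (hk : 1 ≤ k) {p : ℕ → unitInterval} {ε : ℝ}
    (hε : 0 < ε) (hε1 : ε < 1)
    (h : ∀ᶠ n : ℕ in atTop, (p n : ℝ) < (1 - ε) * coreThreshold k n) :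
    Tendsto (fun n => erProb n (p n) (fun G =>
      ∀ S ∈ Finset.powersetCard k Finset.univ, ¬ ClosedOutside k S G)) atTop (𝓝 0) := by
  have hp0 : ∀ n, (0 : ℝ) ≤ p n := fun n => (p n).2.1
  have hpa : ∀ᶠ n : ℕ in atTop, (p n : ℝ) ≤ coreThreshold k n := by
    filter_upwards [h] with n hn
    nlinarith [coreThreshold_nonneg k n]
  have hp : Tendsto (fun n => (p n : ℝ)) atTop (𝓝 0) :=
    tendsto_of_tendsto_of_tendsto_of_le_of_le' tendsto_const_nhds (tendsto_coreThreshold hk)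
      (.of_forall hp0) hpa
  have hx : Tendsto (fun n => (p n : ℝ) ^ k) atTop (𝓝 0) := by
    have := hp.pow k
    rwa [zero_pow (by omega)] at this
  have hxn : ∀ᶠ n : ℕ in atTop, (p n : ℝ) ^ k * n ≤ (1 - ε) * (k * log n) := by
    filter_upwards [h, eventually_ge_atTop 1] with n hn hn1
    have hlog := log_natCast_nonneg n
    calc (p n : ℝ) ^ k * n ≤ ((1 - ε) * coreThreshold k n) ^ k * n := by
          gcongr
          exact hp0 n
      _ = (1 - ε) ^ k * (k * log n) := by
          rw [mul_pow, mul_assoc, coreThreshold_pow_mul hk hn1]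
      _ ≤ _ := by
          gcongr
          exact pow_le_of_le_one (by linarith) (by linarith) (by omega)
  have hpxn : Tendsto (fun n : ℕ => (p n : ℝ) * ((p n : ℝ) ^ k * n)) atTop (𝓝 0) := by
    have hlim := (tendsto_coreThreshold_mul_log hk).const_mul (k : ℝ)
    rw [mul_zero] at hlim
    refine tendsto_of_tendsto_of_tendsto_of_le_of_le' tendsto_const_nhds hlim
      (.of_forall fun n => mul_nonneg (hp0 n) (mul_nonneg (pow_nonneg (hp0 n) k)
        (Nat.cast_nonneg n))) ?_
    filter_upwards [hpa, hxn] with n h1 h2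
    have hlog := log_natCast_nonneg n
    calc (p n : ℝ) * ((p n : ℝ) ^ k * n) ≤ p n * (k * log n) := by
          refine mul_le_mul_of_nonneg_left (h2.trans ?_) (hp0 n)
          have : 0 ≤ k * log n := by positivity
          nlinarith
      _ ≤ coreThreshold k n * (k * log n) := by gcongr
      _ = _ := by ring
  have hρ : Tendsto (fun n : ℕ => exp (4 * ((p n : ℝ) * ((p n : ℝ) ^ k * n))) /
      (1 - (p n : ℝ) ^ k) ^ (2 * k)) atTop (𝓝 1) := by
    have h1 := (continuous_exp.tendsto _).comp (hpxn.const_mul 4)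
    have h2 := (tendsto_const_nhds (x := (1 : ℝ)).sub hx).pow (2 * k)
    have h3 := h1.div h2 (by simp)
    simp only [mul_zero, exp_zero, sub_zero, one_pow, div_one] at h3
    exact h3
  have hE : Tendsto (fun n : ℕ => 2 ^ k * k.factorial * exp (-(ε ^ 2 * k * log n)))
      atTop (𝓝 0) := by
    have hk0 : (0 : ℝ) < k := by exact_mod_cast hk
    have := (tendsto_exp_neg_mul_log (c := ε ^ 2 * k) (by positivity)).const_mul
      ((2 : ℝ) ^ k * k.factorial)
    rwa [mul_zero] at this
  have hlim := (hE.add hρ).sub_const 1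
  rw [zero_add, sub_self] at hlim
  refine tendsto_of_tendsto_of_tendsto_of_le_of_le' tendsto_const_nhds hlim
    (.of_forall fun n => erProb_nonneg _) ?_
  filter_upwards [hxn, eventually_ge_atTop (2 * k), eventually_ge_atTop 1,
    hx.eventually_le_const (show (0 : ℝ) < 1 / 2 by norm_num),
    hx.eventually_le_const (show 0 < ε / (1 + ε) by positivity)] with n hxn hkn hn hx1 hx2
  refine (erProb_forall_not_closedOutside_le hk hkn hx1 rfl).trans ?_
  have hexp := exp_le_expected_closed hkn hn hε (pow_nonneg (hp0 n) k) hx2 hxn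
  gcongr
  calc 1 / (n.choose k * (1 - (p n : ℝ) ^ k) ^ (n - k))
      ≤ 1 / (exp (ε ^ 2 * k * log n) / (2 ^ k * k.factorial)) := by gcongr
    _ = _ := by rw [exp_neg]; field_simp

lemma tendsto_erProb_exists_isKClosedSet_ncard_eq {k : ℕ} (hk : 1 ≤ k) {p : ℕ → unitInterval}
    {ε : ℝ} (hε : 0 < ε) (h : ∀ᶠ n : ℕ in atTop, (p n : ℝ) < (1 - ε) * coreThreshold k n) :
    Tendsto (fun n => erProb n (p n) (fun G => ∃ S, IsKClosedSet G k S ∧ S.ncard = k))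
      atTop (𝓝 1) := by
  -- For `ε ≥ 1` the hypothesis would force a negative probability.
  have hε1 : ε < 1 := by
    obtain ⟨n, hn⟩ := h.exists
    by_contra! hε1
    nlinarith [coreThreshold_nonneg k n, (p n).2.1]
  have hlim := (tendsto_erProb_forall_not_closedOutside hk hε hε1 h).const_sub 1
  rw [sub_zero] at hlim
  refine tendsto_of_tendsto_of_tendsto_of_le_of_le' hlim tendsto_const_nhds ?_
    (.of_forall fun n => erProb_le_one _)
  filter_upwards [eventually_gt_atTop k] with n hn
  rw [← erProb_not]
  refine erProb_mono fun G hG => ?_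
  push Not at hG
  obtain ⟨S, hS, hcl⟩ := hG
  have hc : (S : Set (Fin n)).ncard = k := by
    rw [Set.ncard_coe_finset, (Finset.mem_powersetCard.1 hS).2]
  refine ⟨S, ⟨?_, hc.ge, hc ▸ hn, fun v hv => hcl v (by simpa using hv)⟩, hc⟩
  exact Set.nonempty_of_ncard_ne_zero (by omega)

lemma tendsto_erProb_zero_of_imp {p : ℕ → unitInterval} {P Q : ∀ n, SimpleGraph (Fin n) → Prop}
    (hQ : Tendsto (fun n => erProb n (p n) (Q n)) atTop (𝓝 0)) (h : ∀ n G, P n G → Q n G) :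
    Tendsto (fun n => erProb n (p n) (P n)) atTop (𝓝 0) :=
  squeeze_zero (fun _ => erProb_nonneg _) (fun n => erProb_mono (h n)) hQ

end SecondMoment

theorem theorem3 (k : ℕ) (hk : 1 ≤ k) (p : ℕ → unitInterval) (ε : ℝ) (hε : 0 < ε) :
    ((∀ᶠ n : ℕ in atTop, (1 + ε) * NetworkCores.coreThreshold k n < (p n : ℝ)) →
      Tendsto (fun n : ℕ => NetworkCores.erProb n (p n)
        (fun G => ∃ S, NetworkCores.IsKClosedSet G k S)) atTop (𝓝 0) ∧
      Tendsto (fun n : ℕ => NetworkCores.erProb n (p n)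
        (fun G => ∃ H : G.Subgraph, NetworkCores.IsWeakKCore k H)) atTop (𝓝 0) ∧
      Tendsto (fun n : ℕ => NetworkCores.erProb n (p n)
        (fun G => ∃ H : G.Subgraph, NetworkCores.IsKCore k H)) atTop (𝓝 0) ∧
      Tendsto (fun n : ℕ => NetworkCores.erProb n (p n)
        (fun G => ∃ S, NetworkCores.IsProperConvention G k S)) atTop (𝓝 0) ∧
      Tendsto (fun n : ℕ => NetworkCores.erProb n (p n)
        (fun G => ∃ S, NetworkCores.IsProperTightConvention G k S)) atTop (𝓝 0)) ∧
    ((∀ᶠ n : ℕ in atTop, (p n : ℝ) < (1 - ε) * NetworkCores.coreThreshold k n) →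
      Tendsto (fun n : ℕ => NetworkCores.erProb n (p n)
        (fun G => ∃ S, NetworkCores.IsKClosedSet G k S)) atTop (𝓝 1) ∧
      Tendsto (fun n : ℕ => NetworkCores.erProb n (p n)
        (fun G => ∃ S, NetworkCores.IsKClosedSet G k S ∧ S.ncard = k)) atTop (𝓝 1)) := by
  refine ⟨fun h => ?_, fun h => ?_⟩
  · have hcl := tendsto_erProb_exists_isKClosedSet hk hε h
    refine ⟨hcl, ?_, ?_, ?_, ?_⟩
    · exact tendsto_erProb_zero_of_imp hcl fun n G ⟨H, hH⟩ => ⟨_, hH.isKClosedSet⟩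
    · exact tendsto_erProb_zero_of_imp hcl fun n G ⟨H, hH⟩ => ⟨_, hH.isWeakKCore.isKClosedSet⟩
    · exact tendsto_erProb_zero_of_imp hcl fun n G ⟨S, hS⟩ => ⟨S, hS.isKClosedSet⟩
    · exact tendsto_erProb_zero_of_imp hcl fun n G ⟨S, hS⟩ => ⟨S, hS.1.isKClosedSet⟩
  · have hcl := tendsto_erProb_exists_isKClosedSet_ncard_eq hk hε h
    exact ⟨tendsto_of_tendsto_of_tendsto_of_le_of_le hcl tendsto_const_nhds
      (fun n => NetworkCores.erProb_mono fun G ⟨S, hS, _⟩ => ⟨S, hS⟩)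
      (fun n => NetworkCores.erProb_le_one _), hcl⟩
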